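/- Let $n\ge 0$, let $\mathfrak u(n)$ be the real Lie algebra of skew-Hermitian complex $n\times n$ matrices, with Killing form $B(X,Y)=\operatorname{tr}(\operatorname{ad}X\circ\operatorname{ad}Y)$, and let $U(n)$ act on $\mathfrak u(n)$ by $\mathrm{Ad}(g)X=gXg^{-1}$. Let $h\in\mathfrak u(n)$, and let $H(\lambda)=\{\,\mathrm{Ad}(g)h : g\in U(n)\,\}$ be its adjoint orbit, $\lambda$ denoting the eigenvalues of $h$ with multiplicity. Then $H(\lambda)$, with the subspace topology, has the structure of a smooth manifold for which the inclusion into $\mathfrak u(n)$ is a smooth embedding; its tangent space at $x\in H(\lambda)$, viewed in $\mathfrak u(n)$, is $T_xH(\lambda)=\{[x,X] : X\in\mathfrak u(n)\}$; and there is exactly one field $\Omega=(\Omega_x)_{x\in H(\lambda)}$ of alternating bilinear forms $\Omega_x$ on $T_xH(\lambda)$ such that $$\Omega_x([x,X],[x,Y]) = B(x,[X,Y])\qquad\text{for all } x\in H(\lambda),\ X,Y\in\mathfrak u(n).$$ This $\Omega$ is smooth, closed ($d\Omega=0$) and nondegenerate, and it is invariant under $U(n)$: every $g\in U(n)$ acts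 on $H(\lambda)$ by a smooth map $\ell_g(x)=\mathrm{Ad}(g)x$ with $\ell_g^*\Omega=\Omega$. In particular every adjoint orbit of $U(n)$ is a symplectic manifold. -/

import Mathlib

open scoped Matrix Manifold ContDiff

noncomputable section

namespace UnitaryOrbit

attribute [local instance] LieRing.ofAssociativeRing

/-- The Lie algebra `𝔲(n)` of skew-Hermitian `n × n` complex matrices, a real Lie algebra under the
commutator bracket. -/
def u (n : ℕ) : LieSubalgebra ℝ (Matrix (Fin n) (Fin n) ℂ) where
  carrier := {A | A + Aᴴ = 0}
  zero_mem' := by simp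
  add_mem' := by
    intro A B hA hB
    have hA' : Aᴴ = -A := (neg_eq_of_add_eq_zero_right hA).symm
    have hB' : Bᴴ = -B := (neg_eq_of_add_eq_zero_right hB).symm
    simp only [Set.mem_ofPred_eq, Matrix.conjTranspose_add, hA', hB']
    abel
  smul_mem' := by
    intro c A hA
    have hA' : Aᴴ = -A := (neg_eq_of_add_eq_zero_right hA).symm
    simp [Matrix.conjTranspose_smul, hA']
  lie_mem' := by
    intro A B hA hB
    have hA' : Aᴴ = -A := (neg_eq_of_add_eq_zero_right hA).symm
    have hB' : Bᴴ = -B := (neg_eq_of_add_eq_zero_right hB).symm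
    simp [Ring.lie_def, Matrix.conjTranspose_sub, Matrix.conjTranspose_mul, hA', hB']

section Norm

-- The choice of the norm is immaterial: all norms on `𝔲(n)` give the same topology and the same
-- smooth maps.
attribute [local instance] Matrix.normedAddCommGroup Matrix.normedSpace

instance instNormedAddCommGroup (n : ℕ) : NormedAddCommGroup (u n) :=
  NormedAddCommGroup.induced (u n) (Matrix (Fin n) (Fin n) ℂ)
    (LinearMap.toAddMonoidHom (u n).toSubmodule.subtype) Subtype.val_injective

instance instNormedSpace (n : ℕ) : NormedSpace ℝ (u n) :=
  NormedSpace.induced ℝ (u n) (Matrix (Fin n) (Fin n) ℂ) (u n).toSubmodule.subtype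

end Norm

-- Shortcut instances: the topology and uniformity of `𝔲(n)` are found through the norm. They agree
-- with the ones induced from the space of matrices.
instance instUniformSpace (n : ℕ) : UniformSpace (u n) :=
  (instNormedAddCommGroup n).toPseudoMetricSpace.toUniformSpace

instance instTopologicalSpace (n : ℕ) : TopologicalSpace (u n) :=
  (instUniformSpace n).toTopologicalSpace

lemma topology_eq_induced (n : ℕ) : instTopologicalSpace n =
    TopologicalSpace.induced Subtype.val
      (inferInstance : TopologicalSpace (Matrix (Fin n) (Fin n) ℂ)) :=
  rfl

/-- The adjoint action `Ad(g) X = g X g⁻¹` of `U(n)` on `𝔲(n)`. -/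
def Ad {n : ℕ} (g : Matrix.unitaryGroup (Fin n) ℂ) (X : u n) : u n :=
  ⟨(g : Matrix (Fin n) (Fin n) ℂ) * X * (g⁻¹ : Matrix.unitaryGroup (Fin n) ℂ), by
    have hX : (X : Matrix (Fin n) (Fin n) ℂ)ᴴ = -X := (neg_eq_of_add_eq_zero_right X.2).symm
    change _ + _ = _
    simp [← Matrix.star_eq_conjTranspose, mul_assoc]
    simp [Matrix.star_eq_conjTranspose, hX]⟩

/-- The adjoint orbit `{Ad(g) h : g ∈ U(n)}` of `h`. -/
def adjointOrbit {n : ℕ} (h : u n) : Set (u n) :=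
  {Y | ∃ g : Matrix.unitaryGroup (Fin n) ℂ, Y = Ad g h}

lemma Ad_mem_adjointOrbit {n : ℕ} {h : u n} (g : Matrix.unitaryGroup (Fin n) ℂ)
    (x : adjointOrbit h) : Ad g x ∈ adjointOrbit h := by
  obtain ⟨_, k, rfl⟩ := x
  refine ⟨g * k, Subtype.ext ?_⟩
  simp [Ad, mul_assoc]

/-- The action of `U(n)` on an adjoint orbit. -/
def orbitAct {n : ℕ} {h : u n} (g : Matrix.unitaryGroup (Fin n) ℂ) (x : adjointOrbit h) :
    adjointOrbit h :=
  ⟨Ad g x, Ad_mem_adjointOrbit g x⟩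

section Forms

variable {E : Type*} [NormedAddCommGroup E] [NormedSpace ℝ E]
  {M : Type*} [TopologicalSpace M] [ChartedSpace E M]

variable (E M) in
/-- A (not necessarily smooth) field of alternating `2`-forms on the tangent spaces of a manifold
`M` without boundary, modelled on `E`. -/
abbrev TwoFormField : Type _ := ∀ x : M, TangentSpace 𝓘(ℝ, E) x [⋀^Fin 2]→L[ℝ] ℝ

/-- The expression of a field of `2`-forms in a chart `e`, that is, its pullback under the
parametrization `e.symm : e.target → M`. -/
def TwoFormField.inChart (Ω : TwoFormField E M) (e : OpenPartialHomeomorph M E) (y : E) :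
    E [⋀^Fin 2]→L[ℝ] ℝ :=
  (Ω (e.symm y)).compContinuousLinearMap (mfderiv 𝓘(ℝ, E) 𝓘(ℝ, E) e.symm y)

/-- A symplectic form: a smooth, closed and nondegenerate `2`-form. -/
structure IsSymplectic (Ω : TwoFormField E M) : Prop where
  smooth : ∀ e ∈ atlas E M, ContDiffOn ℝ ∞ (Ω.inChart e) e.target
  closed : ∀ e ∈ atlas E M, ∀ y ∈ e.target, extDeriv (Ω.inChart e) y = 0
  nondegenerate : ∀ (x : M) (v : TangentSpace 𝓘(ℝ, E) x),
    (∀ w : TangentSpace 𝓘(ℝ, E) x, Ω x ![v, w] = 0) → v = 0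

end Forms

section Orbit

variable {n : ℕ} {h : u n} {E : Type*} [NormedAddCommGroup E] [NormedSpace ℝ E]
  [ChartedSpace E (adjointOrbit h)]

variable (E) in
/-- The differential at `x` of the inclusion of the orbit into `𝔲(n)`; it identifies tangent vectors
of the orbit with elements of `𝔲(n)`. -/
def inclDeriv (x : adjointOrbit h) : TangentSpace 𝓘(ℝ, E) x →L[ℝ] u n :=
  mfderiv 𝓘(ℝ, E) 𝓘(ℝ, u n) (Subtype.val : adjointOrbit h → u n) x

/-- `Ω_x([x, X], [x, Y]) = B(x, [X, Y])` at every point `x` of the orbit and for all `X, Y ∈ 𝔲(n)`,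
where `B` is the Killing form of `𝔲(n)`. -/
def IsOrbitForm (Ω : TwoFormField E (adjointOrbit h)) : Prop :=
  ∀ (x : adjointOrbit h) (X Y : u n) (v w : TangentSpace 𝓘(ℝ, E) x),
    inclDeriv E x v = ⁅(x : u n), X⁆ → inclDeriv E x w = ⁅(x : u n), Y⁆ →
      Ω x ![v, w] = killingForm ℝ (u n) x ⁅X, Y⁆

/-- `Ω` is invariant under the action of `U(n)`: each `g` acts smoothly on the orbit and pulls
`Ω` back to itself. -/
def IsInvariant (Ω : TwoFormField E (adjointOrbit h)) : Prop :=
  ∀ g : Matrix.unitaryGroup (Fin n) ℂ,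
    ContMDiff 𝓘(ℝ, E) 𝓘(ℝ, E) ∞ (orbitAct g : adjointOrbit h → adjointOrbit h) ∧
    ∀ x : adjointOrbit h,
      (Ω (orbitAct g x)).compContinuousLinearMap
        (mfderiv 𝓘(ℝ, E) 𝓘(ℝ, E) (orbitAct g) x) = Ω x

end Orbit

end UnitaryOrbit

end

/-!
Write `B` for the Killing form. For every `X ∈ 𝔲(n)` the map `ad X` is skew-adjoint for the inner
product `-Re tr(X Y)`, so `𝔲(n)` is the direct sum of the range and the kernel of `ad h`. Let `k` be
the exponential of a linear section of `X ↦ [X, h]` onto this range. The slice map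
`(v, Z) ↦ Ad(k v) (h + Z)`, with `Z` in the kernel of `ad h`, is then a local diffeomorphism at the
origin. It takes values in the orbit only for `Z = 0`: all elements of the orbit are roots of the
minimal polynomial of `h`, which is separable, and Newton's argument shows that `h` is an isolated
root of it among the matrices that commute with `h`. The slice map and its translates by the adjoint
action therefore give submanifold charts.

In these charts the orbit is parametrized by maps of the form `Ad(k) h`, where `k` takes values in
`U(n)`. By the Maurer–Cartan equation for `k⁻¹ dk`, the pullback of `Ω` under such a map is minus
the exterior derivative of `B(h, k⁻¹ dk)`, whence `Ω` is smooth and closed. If `[x, X]` is in the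
radical of `Ω_x`, then pairing it with `[x, [x, X]]` shows that `B` vanishes at `([x, X], [x, X])`.
The trace of the square of a skew-adjoint map is negative unless the map is zero, so `[x, X]` is
central. It is also in the range of `ad X`, which meets the kernel of `ad X` only in `0`.
-/

noncomputable section

namespace UnitaryOrbit

attribute [local instance] LieRing.ofAssociativeRing

section SkewAdjoint

variable {K W : Type*} [Field K] [AddCommGroup W] [Module K W] {q : LinearMap.BilinForm K W}

lemma repr_mul_self_of_isOrthoᵢ {ι : Type*} {b : Module.Basis ι K W} (hb : q.IsOrthoᵢ b) (i : ι)
    (x : W) : b.repr x i * q (b i) (b i) = q x (b i) := by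
  have hsum : q x (b i) = (b.repr x).sum fun j c => c * q (b j) (b i) := by
    conv_lhs => rw [← b.linearCombination_repr x]
    simp [Finsupp.linearCombination_apply, Finsupp.sum]
  rw [hsum, Finsupp.sum, Finset.sum_eq_single i]
  · intro j _ hj
    rw [hb hj, mul_zero]
  · intro hi
    rw [Finsupp.notMem_support_iff.1 hi, zero_mul]

variable [LinearOrder K] [FiniteDimensional K W]

lemma isCompl_range_ker_of_isSkewAdjoint (hpos : ∀ x ≠ 0, 0 < q x x) {T : Module.End K W}
    (hT : q.IsSkewAdjoint T) : IsCompl (LinearMap.range T) (LinearMap.ker T) := by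
  refine (Submodule.isCompl_iff_disjoint _ _ T.finrank_range_add_finrank_ker.ge).2 ?_
  rw [Submodule.disjoint_def]
  rintro _ ⟨x, rfl⟩ hx
  by_contra hne
  refine (hpos _ hne).ne' ?_
  rw [hT, Pi.neg_apply, hx, neg_zero, map_zero]

variable [IsStrictOrderedRing K]

lemma eq_zero_of_isSkewAdjoint_of_trace_mul_self (hq : LinearMap.IsSymm q)
    (hpos : ∀ x ≠ 0, 0 < q x x) {T : Module.End K W} (hT : q.IsSkewAdjoint T)
    (htr : LinearMap.trace K W (T * T) = 0) : T = 0 := by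
  obtain ⟨b, hb⟩ := LinearMap.BilinForm.exists_orthogonal_basis hq
  have hbpos : ∀ i, 0 < q (b i) (b i) := fun i => hpos _ (b.ne_zero i)
  have hnonneg : ∀ x, 0 ≤ q x x := fun x => by
    rcases eq_or_ne x 0 with rfl | hx
    · simp
    · exact (hpos x hx).le
  have hdiag : ∀ i, b.repr (T (T (b i))) i = -(q (T (b i)) (T (b i)) / q (b i) (b i)) := fun i => by
    rw [← neg_div, eq_div_iff (hbpos i).ne', repr_mul_self_of_isOrthoᵢ hb, hT]
    simp
  have hsum : ∑ i, q (T (b i)) (T (b i)) / q (b i) (b i) = 0 := by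
    rw [LinearMap.trace_eq_matrix_trace K b, Matrix.trace] at htr
    simpa only [Matrix.diag_apply, LinearMap.toMatrix_apply, Module.End.mul_apply, hdiag,
      Finset.sum_neg_distrib, neg_eq_zero] using htr
  rw [Finset.sum_eq_zero_iff_of_nonneg fun i _ => div_nonneg (hnonneg _) (hbpos i).le] at hsum
  refine b.ext fun i => ?_
  by_contra hne
  exact (div_pos (hpos _ hne) (hbpos i)).ne' (hsum i (Finset.mem_univ i))

end SkewAdjoint

section KillingForm

variable {K L : Type*}

lemma killingForm_lie_congr [CommRing K] [LieRing L] [LieAlgebra K L] {x X X' Y Y' : L}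
    (hX : ⁅x, X⁆ = ⁅x, X'⁆) (hY : ⁅x, Y⁆ = ⁅x, Y'⁆) :
    killingForm K L x ⁅X, Y⁆ = killingForm K L x ⁅X', Y'⁆ := by
  have invariant := LieModule.traceForm_apply_lie_apply K L L
  calc killingForm K L x ⁅X, Y⁆ = killingForm K L x ⁅X', Y⁆ := by
        rw [← invariant, hX, invariant]
    _ = killingForm K L x ⁅X', Y'⁆ := by
        rw [← lie_skew X' Y, ← lie_skew X' Y', map_neg, map_neg, ← invariant, hY, invariant]

lemma isSkewAdjoint_ad [CommRing K] [LieRing L] [LieAlgebra K L] {q : LinearMap.BilinForm K L}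
    (hinv : q.lieInvariant L) (x : L) : q.IsSkewAdjoint (LieAlgebra.ad K L x) := fun y z => by
  rw [LieAlgebra.ad_apply, hinv, Pi.neg_apply, map_neg, LieAlgebra.ad_apply]

variable [Field K] [LinearOrder K] [LieRing L] [LieAlgebra K L] [FiniteDimensional K L]
  {q : LinearMap.BilinForm K L}

lemma isCompl_range_ker_ad (hpos : ∀ x ≠ 0, 0 < q x x) (hinv : q.lieInvariant L) (x : L) :
    IsCompl (LinearMap.range (LieAlgebra.ad K L x)) (LinearMap.ker (LieAlgebra.ad K L x)) :=
  isCompl_range_ker_of_isSkewAdjoint hpos (isSkewAdjoint_ad hinv x)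

variable [IsStrictOrderedRing K]

lemma ad_eq_zero_of_killingForm_self (hq : LinearMap.IsSymm q) (hpos : ∀ x ≠ 0, 0 < q x x)
    (hinv : q.lieInvariant L) {x : L} (hx : killingForm K L x x = 0) :
    LieAlgebra.ad K L x = 0 :=
  eq_zero_of_isSkewAdjoint_of_trace_mul_self hq hpos (isSkewAdjoint_ad hinv x) hx

lemma lie_eq_zero_of_killingForm_eq_zero (hq : LinearMap.IsSymm q) (hpos : ∀ x ≠ 0, 0 < q x x)
    (hinv : q.lieInvariant L) {x y : L} (hxy : killingForm K L ⁅x, y⁆ ⁅x, y⁆ = 0) :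
    ⁅x, y⁆ = 0 := by
  have had : ⁅⁅x, y⁆, y⁆ = 0 :=
    LinearMap.congr_fun (ad_eq_zero_of_killingForm_self hq hpos hinv hxy) y
  have hker : ⁅x, y⁆ ∈ LinearMap.ker (LieAlgebra.ad K L y) := by
    rw [LinearMap.mem_ker, LieAlgebra.ad_apply, ← lie_skew, had, neg_zero]
  have hrange : ⁅x, y⁆ ∈ LinearMap.range (LieAlgebra.ad K L y) :=
    ⟨-x, by rw [map_neg, LieAlgebra.ad_apply, lie_skew]⟩
  exact Submodule.disjoint_def.1 (isCompl_range_ker_ad hpos hinv y).disjoint _ hrange hker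

end KillingForm

section IsolatedRoots

open Polynomial

-- The two-variable Taylor expansion, evaluated at commuting elements of a noncommutative algebra.
lemma exists_aeval_add_of_commute {R A : Type*} [CommRing R] [Ring A] [Algebra R A] (p : R[X])
    (a : A) : ∃ r : A[X], ∀ z, Commute a z →
      aeval (a + z) p = aeval a p + (aeval a (derivative p) + r.eval z * z) * z := by
  obtain ⟨k, hk⟩ := binomExpansion (p.map (algebraMap R R[X][X])) (C X) X
  refine ⟨k.map (aeval a : R[X] →ₐ[R] A).toRingHom, fun z hz => ?_⟩
  have hcomm : ∀ f : R[X], Commute (aeval a f) z := fun f =>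
    (Algebra.commute_of_mem_adjoin_singleton_of_commute (aeval_mem_adjoin_singleton R a)
      hz.symm).symm
  let φ : R[X][X] →ₐ[R] A := eval₂AlgHom (aeval a) z hcomm
  have hX : φ X = z := eval₂_X _ _
  have hC : ∀ f : R[X], φ (C f) = aeval a f := fun f => eval₂_C _ _
  have hφ := congrArg φ hk
  simp only [eval_map_algebraMap, derivative_map, map_add, map_mul, map_pow, ← aeval_algHom_apply,
    hX, hC, aeval_X] at hφ
  rw [hφ, add_assoc, add_mul, sq, mul_assoc, eval_map]
  rfl

lemma isUnit_aeval_derivative_of_separable {R A : Type*} [CommRing R] [Ring A] [Algebra R A]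
    {p : R[X]} (hp : p.Separable) {a : A} (ha : aeval a p = 0) :
    IsUnit (aeval a (derivative p)) := by
  obtain ⟨f, g, hfg⟩ := hp
  have hinv : aeval a g * aeval a (derivative p) = 1 := by
    simpa [ha] using congrArg (aeval a) hfg
  have hinv' : aeval a (derivative p) * aeval a g = 1 := by
    rwa [← map_mul, mul_comm, map_mul]
  exact ⟨⟨_, _, hinv', hinv⟩, rfl⟩

lemma eventually_eq_zero_of_aeval_add_eq_zero {R A : Type*} [CommRing R] [NormedRing A]
    [HasSummableGeomSeries A] [Algebra R A] {p : R[X]} (hp : p.Separable) {a : A}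
    (ha : aeval a p = 0) :
    ∀ᶠ z in nhds (0 : A), Commute a z → aeval (a + z) p = 0 → z = 0 := by
  obtain ⟨r, hr⟩ := exists_aeval_add_of_commute p a
  have hcont : Continuous fun z : A => aeval a (derivative p) + r.eval z * z := by fun_prop
  have hnear : ∀ᶠ z in nhds (0 : A), IsUnit (aeval a (derivative p) + r.eval z * z) :=
    hcont.continuousAt.eventually (Units.isOpen.mem_nhds (by
      simpa using isUnit_aeval_derivative_of_separable hp ha))
  filter_upwards [hnear] with z hz hcomm hroot
  rw [hr z hcomm, ha, zero_add] at hroot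
  exact hz.mul_right_eq_zero.1 hroot

end IsolatedRoots

section SkewHermitian

variable {n : ℕ}

lemma conjTranspose_coe (X : u n) : (X : Matrix (Fin n) (Fin n) ℂ)ᴴ = -X :=
  (neg_eq_of_add_eq_zero_right X.2).symm

lemma isSemisimple_toEuclideanLin_coe (X : u n) :
    Module.End.IsSemisimple (Matrix.toEuclideanLin (X : Matrix (Fin n) (Fin n) ℂ)) := by
  have hermitian : (Complex.I • (X : Matrix (Fin n) (Fin n) ℂ)).IsHermitian := by
    rw [Matrix.IsHermitian, Matrix.conjTranspose_smul, conjTranspose_coe]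
    simp
  rw [← Module.End.IsSemisimple_smul_iff Complex.I_ne_zero, ← map_smul,
    ← Module.End.isFinitelySemisimple_iff_isSemisimple]
  exact (Matrix.isSymmetric_toEuclideanLin_iff.2 hermitian).isFinitelySemisimple

lemma separable_minpoly_coe (X : u n) :
    (minpoly ℂ (X : Matrix (Fin n) (Fin n) ℂ)).Separable := by
  rw [← minpoly.algEquiv_eq (Matrix.toLpLinAlgEquiv (R := ℂ) 2),
    PerfectField.separable_iff_squarefree]
  exact (isSemisimple_toEuclideanLin_coe X).minpoly_squarefree

end SkewHermitian

section OneForms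

variable {𝕜 E F : Type*} [NontriviallyNormedField 𝕜] [NormedAddCommGroup E] [NormedSpace 𝕜 E]
  [NormedAddCommGroup F] [NormedSpace 𝕜 F]

lemma extDeriv_ofSubsingleton_apply {θ : E → E →L[𝕜] F} {e : E} (hθ : DifferentiableAt 𝕜 θ e)
    (v w : E) :
    extDeriv (fun e => ContinuousAlternatingMap.ofSubsingleton 𝕜 E F (0 : Fin 1) (θ e)) e ![v, w] =
      fderiv 𝕜 θ e v w - fderiv 𝕜 θ e w v := by
  have hcomp := (ContinuousAlternatingMap.ofSubsingletonLIE (𝕜 := 𝕜) (E := E) (F := F)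
    (0 : Fin 1)).toContinuousLinearEquiv.toContinuousLinearMap.hasFDerivAt.comp e hθ.hasFDerivAt
  have hfderiv : fderiv 𝕜 (fun e => ContinuousAlternatingMap.ofSubsingleton 𝕜 E F (0 : Fin 1)
      (θ e)) e = _ := hcomp.fderiv
  rw [extDeriv, hfderiv, ContinuousAlternatingMap.alternatizeUncurryFin_apply, Fin.sum_univ_two]
  simp [sub_eq_add_neg, Fin.removeNth]

end OneForms

section TwoForms

variable {𝕜 E F G : Type*} [NontriviallyNormedField 𝕜] [NormedAddCommGroup E] [NormedSpace 𝕜 E]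
  [NormedAddCommGroup F] [NormedSpace 𝕜 F] [NormedAddCommGroup G] [NormedSpace 𝕜 G]

lemma continuousAlternatingMap_ext_pair {α β : E [⋀^Fin 2]→L[𝕜] G}
    (H : ∀ v w, α ![v, w] = β ![v, w]) : α = β :=
  ContinuousAlternatingMap.ext fun v => by
    rw [← FinVec.etaExpand_eq v]
    exact H _ _

lemma compContinuousLinearMap_apply_pair (α : F [⋀^Fin 2]→L[𝕜] G) (f : E →L[𝕜] F) (v w : E) :
    α.compContinuousLinearMap f ![v, w] = α ![f v, f w] := by
  rw [ContinuousAlternatingMap.compContinuousLinearMap_apply, ← FinVec.etaExpand_eq (f ∘ _)]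
  rfl

end TwoForms

section MaurerCartan

variable {𝕜 E A : Type*} [NontriviallyNormedField 𝕜] [NormedAddCommGroup E] [NormedSpace 𝕜 E]
  [NormedRing A] [NormedAlgebra 𝕜 A] {k : E → Aˣ} {e : E}

variable (𝕜) in
/-- The logarithmic derivative `k⁻¹ dk` of a map `k` into the group of units of a normed algebra,
that is, the pullback of the left-invariant Maurer–Cartan form under `k`. -/
def maurerCartan (k : E → Aˣ) (e : E) : E →L[𝕜] A :=
  (ContinuousLinearMap.mul 𝕜 A ↑(k e)⁻¹).comp (fderiv 𝕜 (fun e => (k e : A)) e)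

lemma fderiv_coe_eq_mul_maurerCartan (v : E) :
    fderiv 𝕜 (fun e => (k e : A)) e v = k e * maurerCartan 𝕜 k e v := by
  simp [maurerCartan]

variable [HasSummableGeomSeries A]

lemma hasFDerivAt_coe_inv (hk : DifferentiableAt 𝕜 (fun e => (k e : A)) e) :
    HasFDerivAt (fun e => (↑(k e)⁻¹ : A))
      (((ContinuousLinearMap.mul 𝕜 A).flip ↑(k e)⁻¹).comp (-maurerCartan 𝕜 k e)) e := by
  have hinv := (hasFDerivAt_ringInverse (𝕜 := 𝕜) (k e)).comp e hk.hasFDerivAt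
  simp only [Function.comp_def, Ring.inverse_unit] at hinv
  refine hinv.congr_fderiv ?_
  ext v
  simp [maurerCartan]

lemma fderiv_coe_inv_apply (hk : DifferentiableAt 𝕜 (fun e => (k e : A)) e) (v : E) :
    fderiv 𝕜 (fun e => (↑(k e)⁻¹ : A)) e v = -(maurerCartan 𝕜 k e v * ↑(k e)⁻¹) := by
  simp [(hasFDerivAt_coe_inv hk).fderiv]

lemma fderiv_conj_apply {a : E → A} (hk : DifferentiableAt 𝕜 (fun e => (k e : A)) e)
    (ha : DifferentiableAt 𝕜 a e) (v : E) :
    fderiv 𝕜 (fun e => ↑(k e) * a e * ↑(k e)⁻¹) e v =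
      k e * (⁅maurerCartan 𝕜 k e v, a e⁆ + fderiv 𝕜 a e v) * ↑(k e)⁻¹ := by
  rw [fderiv_fun_mul' (hk.fun_mul ha) (hasFDerivAt_coe_inv hk).differentiableAt,
    fderiv_fun_mul' hk ha]
  simp only [add_apply, smul_apply, smul_eq_mul, MulOpposite.smul_eq_mul_unop, MulOpposite.unop_op,
    fderiv_coe_inv_apply hk, fderiv_coe_eq_mul_maurerCartan, Ring.lie_def]
  noncomm_ring

variable {n : WithTop ℕ∞}

lemma contDiff_coe_inv (hk : ContDiff 𝕜 n fun e => (k e : A)) :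
    ContDiff 𝕜 n fun e => (↑(k e)⁻¹ : A) := by
  refine contDiff_iff_contDiffAt.2 fun e => ?_
  simpa only [Function.comp_def, Ring.inverse_unit] using
    (contDiffAt_ringInverse 𝕜 (k e)).comp e hk.contDiffAt

lemma contDiff_maurerCartan {m : WithTop ℕ∞} (hk : ContDiff 𝕜 n fun e => (k e : A))
    (hmn : m + 1 ≤ n) : ContDiff 𝕜 m (maurerCartan 𝕜 k) :=
  ((ContinuousLinearMap.mul 𝕜 A).contDiff.comp
    ((contDiff_coe_inv hk).of_le (le_self_add.trans hmn))).clm_comp (hk.fderiv_right hmn)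

lemma fderiv_maurerCartan_apply (hk : ContDiff 𝕜 n fun e => (k e : A)) (hn : 2 ≤ n) (e v w : E) :
    fderiv 𝕜 (maurerCartan 𝕜 k) e v w = ↑(k e)⁻¹ * fderiv 𝕜 (fderiv 𝕜 fun e => (k e : A)) e v w -
      maurerCartan 𝕜 k e v * maurerCartan 𝕜 k e w := by
  have hinv : HasFDerivAt _ _ e := hasFDerivAt_coe_inv
    (hk.differentiable (by positivity)).differentiableAt
  have hderiv : DifferentiableAt 𝕜 (fderiv 𝕜 fun e => (k e : A)) e :=
    ((hk.fderiv_right (m := 1) (by simpa [one_add_one_eq_two])).differentiable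
      (by simp)).differentiableAt
  have hμ : fderiv 𝕜 (maurerCartan 𝕜 k) e = _ :=
    (((ContinuousLinearMap.mul 𝕜 A).hasFDerivAt.comp e hinv).clm_comp hderiv.hasFDerivAt).fderiv
  rw [hμ]
  simp [fderiv_coe_eq_mul_maurerCartan, mul_assoc, sub_eq_add_neg]

lemma maurerCartan_equation (hk : ContDiff 𝕜 n fun e => (k e : A)) (hn : minSmoothness 𝕜 2 ≤ n)
    (e v w : E) :
    fderiv 𝕜 (maurerCartan 𝕜 k) e v w - fderiv 𝕜 (maurerCartan 𝕜 k) e w v =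
      -⁅maurerCartan 𝕜 k e v, maurerCartan 𝕜 k e w⁆ := by
  have h2 : 2 ≤ n := le_minSmoothness.trans hn
  rw [fderiv_maurerCartan_apply hk h2, fderiv_maurerCartan_apply hk h2, Ring.lie_def,
    hk.contDiffAt.isSymmSndFDerivAt hn v w]
  abel

end MaurerCartan

section LeftInvariantForms

variable {𝕜 E A F : Type*} [NontriviallyNormedField 𝕜] [NormedAddCommGroup E] [NormedSpace 𝕜 E]
  [NormedRing A] [NormedAlgebra 𝕜 A] [HasSummableGeomSeries A]
  [NormedAddCommGroup F] [NormedSpace 𝕜 F] {k : E → Aˣ} {e : E} {n : WithTop ℕ∞}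

variable (𝕜) in
/-- The pullback under `k` of the left-invariant `1`-form on a group of units that is given by the
linear map `φ` at the identity. -/
def leftInvariantForm (φ : A →L[𝕜] F) (k : E → Aˣ) (e : E) : E [⋀^Fin 1]→L[𝕜] F :=
  ContinuousAlternatingMap.ofSubsingleton 𝕜 E F (0 : Fin 1) (φ.comp (maurerCartan 𝕜 k e))

lemma contDiff_leftInvariantForm {m : WithTop ℕ∞} (φ : A →L[𝕜] F)
    (hk : ContDiff 𝕜 n fun e => (k e : A)) (hmn : m + 1 ≤ n) :
    ContDiff 𝕜 m (leftInvariantForm 𝕜 φ k) :=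
  (ContinuousAlternatingMap.ofSubsingletonLIE (𝕜 := 𝕜) (E := E) (F := F) (0 : Fin 1)).contDiff.comp
    (contDiff_const.clm_comp (contDiff_maurerCartan hk hmn))

lemma extDeriv_leftInvariantForm_apply (φ : A →L[𝕜] F) (hk : ContDiff 𝕜 n fun e => (k e : A))
    (hn : minSmoothness 𝕜 2 ≤ n) (e v w : E) :
    extDeriv (leftInvariantForm 𝕜 φ k) e ![v, w] =
      -φ ⁅maurerCartan 𝕜 k e v, maurerCartan 𝕜 k e w⁆ := by
  have hμ : DifferentiableAt 𝕜 (maurerCartan 𝕜 k) e :=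
    (contDiff_maurerCartan (m := 1) hk (by
      simpa [one_add_one_eq_two] using le_minSmoothness.trans hn)).differentiable (by simp) e
  have hcomp : HasFDerivAt (fun e => φ.comp (maurerCartan 𝕜 k e)) _ e :=
    ((ContinuousLinearMap.compL 𝕜 E A F φ).hasFDerivAt.comp e hμ.hasFDerivAt)
  rw [← map_neg, ← maurerCartan_equation hk hn, map_sub]
  refine (extDeriv_ofSubsingleton_apply hcomp.differentiableAt v w).trans ?_
  simp [hcomp.fderiv]

end LeftInvariantForms

section UnitaryElements

variable {𝕜 E A : Type*} [NontriviallyNormedField 𝕜] [StarRing 𝕜] [TrivialStar 𝕜]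
  [NormedAddCommGroup E] [NormedSpace 𝕜 E]
  [NormedRing A] [NormedAlgebra 𝕜 A] [HasSummableGeomSeries A] [StarRing A] [StarModule 𝕜 A]
  [ContinuousStar A] {k : E → unitary A} {e : E}

lemma star_maurerCartan_toUnits (hk : DifferentiableAt 𝕜 (fun e => (k e : A)) e) (v : E) :
    star (maurerCartan 𝕜 (fun e => Unitary.toUnits (k e)) e v) =
      -maurerCartan 𝕜 (fun e => Unitary.toUnits (k e)) e v := by
  let κ : E → Aˣ := fun e => Unitary.toUnits (k e)
  have hstar : fderiv 𝕜 (fun e => star (κ e : A)) e v = -(maurerCartan 𝕜 κ e v * ↑(κ e)⁻¹) :=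
    fderiv_coe_inv_apply (k := κ) hk v
  have hmul : fderiv 𝕜 (fun e => star (κ e : A)) e v = star (maurerCartan 𝕜 κ e v) * ↑(κ e)⁻¹ := by
    rw [fderiv_star, ContinuousLinearMap.comp_apply]
    exact (congrArg star (fderiv_coe_eq_mul_maurerCartan v)).trans (star_mul _ _)
  rwa [hmul, ← neg_mul, Units.mul_left_inj] at hstar

end UnitaryElements

section UnitaryLieAlgebra

variable {n : ℕ}

lemma coe_Ad (g : Matrix.unitaryGroup (Fin n) ℂ) (X : u n) :
    (Ad g X : Matrix (Fin n) (Fin n) ℂ) = Unitary.conjStarAlgAut ℝ _ g X := rfl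

lemma Ad_mul (g k : Matrix.unitaryGroup (Fin n) ℂ) (X : u n) : Ad (g * k) X = Ad g (Ad k X) :=
  Subtype.ext (by simp only [coe_Ad, Unitary.conjStarAlgAut_mul_apply])

lemma Ad_one (X : u n) : Ad 1 X = X := Subtype.ext (by simp [coe_Ad])

/-- The adjoint action of a unitary matrix as an automorphism of the Lie algebra `𝔲(n)`. -/
def AdEquiv (g : Matrix.unitaryGroup (Fin n) ℂ) : u n ≃ₗ⁅ℝ⁆ u n where
  toFun := Ad g
  invFun := Ad g⁻¹
  map_add' X Y := Subtype.ext (by simp only [coe_Ad, AddMemClass.coe_add, map_add])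
  map_smul' c X := Subtype.ext (by
    simp only [coe_Ad, SetLike.val_smul, map_smul, RingHom.id_apply])
  map_lie' {X Y} := Subtype.ext (by
    simp only [coe_Ad, LieSubalgebra.coe_bracket, Ring.lie_def, map_sub, map_mul])
  left_inv X := by rw [← Ad_mul, inv_mul_cancel, Ad_one]
  right_inv X := by rw [← Ad_mul, mul_inv_cancel, Ad_one]

lemma Ad_lie (g : Matrix.unitaryGroup (Fin n) ℂ) (X Y : u n) : Ad g ⁅X, Y⁆ = ⁅Ad g X, Ad g Y⁆ :=
  (AdEquiv g).map_lie X Y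

lemma killingForm_Ad (g : Matrix.unitaryGroup (Fin n) ℂ) (X Y : u n) :
    killingForm ℝ (u n) (Ad g X) (Ad g Y) = killingForm ℝ (u n) X Y :=
  LieAlgebra.killingForm_of_equiv_apply (AdEquiv g) X Y

variable (n) in
/-- The inner product `-Re tr(X Y)` on `𝔲(n)`, which is invariant under the adjoint action. -/
def traceInner : LinearMap.BilinForm ℝ (u n) :=
  LinearMap.mk₂ ℝ (fun X Y => -((X : Matrix (Fin n) (Fin n) ℂ) * Y).trace.re)
    (fun X Y Z => by simp [add_mul, add_comm]) (fun c X Y => by simp)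
    (fun X Y Z => by simp [mul_add, add_comm]) (fun c X Y => by simp)

lemma traceInner_apply (X Y : u n) :
    traceInner n X Y = -((X : Matrix (Fin n) (Fin n) ℂ) * Y).trace.re := rfl

lemma isSymm_traceInner : LinearMap.IsSymm (traceInner n) :=
  ⟨fun X Y => by simp [traceInner_apply, Matrix.trace_mul_comm (X : Matrix (Fin n) (Fin n) ℂ)]⟩

lemma lieInvariant_traceInner : (traceInner n).lieInvariant (u n) := fun Z X Y => by
  simp only [traceInner_apply, LieSubalgebra.coe_bracket, Ring.lie_def, sub_mul, mul_sub,
    Matrix.trace_sub, Complex.sub_re, ← mul_assoc,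
    Matrix.trace_mul_cycle (X : Matrix (Fin n) (Fin n) ℂ) (Y : Matrix (Fin n) (Fin n) ℂ)]
  ring

open ComplexOrder in
lemma traceInner_self_pos {X : u n} (hX : X ≠ 0) : 0 < traceInner n X X := by
  have hpos : 0 < ((X : Matrix (Fin n) (Fin n) ℂ)ᴴ * X).trace :=
    (Matrix.PosSemidef.trace_nonneg (Matrix.posSemidef_conjTranspose_mul_self _)).lt_of_ne'
      (mt Matrix.trace_conjTranspose_mul_self_eq_zero_iff.1 (mt (fun h => Subtype.ext h) hX))
  rw [conjTranspose_coe, neg_mul, Matrix.trace_neg] at hpos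
  simpa [traceInner_apply] using (Complex.pos_iff.1 hpos).1

instance instFiniteDimensional : FiniteDimensional ℝ (u n) :=
  inferInstanceAs (FiniteDimensional ℝ (u n).toSubmodule)

instance instContinuousSMul : ContinuousSMul ℝ (u n) := IsBoundedSMul.continuousSMul

instance instT2Space : T2Space (u n) := inferInstance

end UnitaryLieAlgebra

section UnitaryAnalysis

open scoped Matrix.Norms.L2Operator

variable {n : ℕ}

variable (n) in
/-- The inclusion of `𝔲(n)` into the algebra of matrices. -/
def coeCLM : u n →L[ℝ] Matrix (Fin n) (Fin n) ℂ where
  toLinearMap := (u n).toSubmodule.subtype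
  cont := continuous_subtype_val

variable (n) in
/-- The skew-Hermitian part of a matrix. -/
def skewPart : Matrix (Fin n) (Fin n) ℂ →L[ℝ] u n :=
  LinearMap.toContinuousLinearMap (LinearMap.codRestrict (u n).toSubmodule
    ((skewAdjoint.submodule ℝ _).subtype ∘ₗ skewAdjointPart ℝ)
    fun X => add_eq_zero_iff_neg_eq.2 (skewAdjoint.mem_iff.1 (skewAdjointPart ℝ X).2).symm)

lemma coe_skewPart {X : Matrix (Fin n) (Fin n) ℂ} (hX : star X = -X) :
    (skewPart n X : Matrix (Fin n) (Fin n) ℂ) = X :=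
  congrArg Subtype.val
    (LinearMap.congr_fun (skewAdjointPart_comp_subtype_skewAdjoint ℝ) ⟨X, skewAdjoint.mem_iff.2 hX⟩)

lemma skewPart_coe (X : u n) : skewPart n X = X := Subtype.ext (coe_skewPart (conjTranspose_coe X))

variable {E : Type*} [NormedAddCommGroup E] [NormedSpace ℝ E]
  {k : E → Matrix.unitaryGroup (Fin n) ℂ} {a : E → u n} {e : E}

/-- The logarithmic derivative `k⁻¹ dk` of a map `k` into the unitary group, which takes values in
the Lie algebra `𝔲(n)`. -/
def logDeriv (k : E → Matrix.unitaryGroup (Fin n) ℂ) (e : E) : E →L[ℝ] u n :=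
  (skewPart n).comp (maurerCartan ℝ (fun e => Unitary.toUnits (k e)) e)

lemma coe_logDeriv (hk : DifferentiableAt ℝ (fun e => (k e : Matrix (Fin n) (Fin n) ℂ)) e)
    (v : E) : (logDeriv k e v : Matrix (Fin n) (Fin n) ℂ) =
      maurerCartan ℝ (fun e => Unitary.toUnits (k e)) e v :=
  coe_skewPart (star_maurerCartan_toUnits hk v)

lemma Ad_eq_skewPart (g : Matrix.unitaryGroup (Fin n) ℂ) (X : u n) :
    Ad g X = skewPart n (Unitary.toUnits g * coeCLM n X *
      (↑(Unitary.toUnits g)⁻¹ : Matrix (Fin n) (Fin n) ℂ)) :=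
  (skewPart_coe (Ad g X)).symm

lemma contDiff_Ad {m : WithTop ℕ∞} (hk : ContDiff ℝ m fun e => (k e : Matrix (Fin n) (Fin n) ℂ))
    (ha : ContDiff ℝ m a) : ContDiff ℝ m fun e => Ad (k e) (a e) := by
  simp only [Ad_eq_skewPart]
  exact (skewPart n).contDiff.comp
    ((hk.mul ((coeCLM n).contDiff.comp ha)).mul
      (contDiff_coe_inv (k := fun e => Unitary.toUnits (k e)) hk))

lemma fderiv_Ad_apply (hk : DifferentiableAt ℝ (fun e => (k e : Matrix (Fin n) (Fin n) ℂ)) e)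
    (ha : DifferentiableAt ℝ a e) (v : E) :
    fderiv ℝ (fun e => Ad (k e) (a e)) e v = Ad (k e) (⁅logDeriv k e v, a e⁆ + fderiv ℝ a e v) := by
  let κ : E → (Matrix (Fin n) (Fin n) ℂ)ˣ := fun e => Unitary.toUnits (k e)
  have hcoe : DifferentiableAt ℝ (fun e => coeCLM n (a e)) e :=
    (coeCLM n).differentiableAt.comp e ha
  have hκ : DifferentiableAt ℝ (fun e => (κ e : Matrix (Fin n) (Fin n) ℂ)) e := hk
  have hconj : DifferentiableAt ℝ
      (fun e => (κ e : Matrix (Fin n) (Fin n) ℂ) * coeCLM n (a e) *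
        (↑(κ e)⁻¹ : Matrix (Fin n) (Fin n) ℂ)) e :=
    (hκ.fun_mul hcoe).fun_mul (hasFDerivAt_coe_inv hκ).differentiableAt
  have hcoe' : fderiv ℝ (fun e => coeCLM n (a e)) e v = coeCLM n (fderiv ℝ a e v) := by
    rw [fderiv_fun_comp e (coeCLM n).differentiableAt ha, ContinuousLinearMap.fderiv]
    rfl
  simp only [Ad_eq_skewPart]
  rw [fderiv_fun_comp e (skewPart n).differentiableAt hconj, ContinuousLinearMap.fderiv,
    ContinuousLinearMap.comp_apply, fderiv_conj_apply hκ hcoe, hcoe', ← coe_logDeriv hk]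
  rfl

lemma extDeriv_leftInvariantForm_skewPart (φ : u n →L[ℝ] ℝ) {m : WithTop ℕ∞}
    (hk : ContDiff ℝ m fun e => (k e : Matrix (Fin n) (Fin n) ℂ)) (hm : 2 ≤ m) (e v w : E) :
    extDeriv (leftInvariantForm ℝ (φ.comp (skewPart n)) fun e => Unitary.toUnits (k e)) e ![v, w] =
      -φ ⁅logDeriv k e v, logDeriv k e w⁆ := by
  have hd : DifferentiableAt ℝ (fun e => (k e : Matrix (Fin n) (Fin n) ℂ)) e :=
    (hk.differentiable (by positivity)).differentiableAt
  rw [extDeriv_leftInvariantForm_apply _ hk (by simpa using hm), ContinuousLinearMap.comp_apply,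
    ← coe_logDeriv hd, ← coe_logDeriv hd, ← LieSubalgebra.coe_bracket, skewPart_coe]

/-- The exponential of a skew-Hermitian matrix, a unitary matrix. -/
def expUnitary (X : u n) : Matrix.unitaryGroup (Fin n) ℂ :=
  ⟨NormedSpace.exp (X : Matrix (Fin n) (Fin n) ℂ),
    let +nondep : NormedAlgebra ℚ (Matrix (Fin n) (Fin n) ℂ) := .restrictScalars ℚ ℝ _
    NormedSpace.exp_mem_unitary_of_mem_skewAdjoint (conjTranspose_coe X)⟩

lemma expUnitary_zero : expUnitary (0 : u n) = 1 := Subtype.ext NormedSpace.exp_zero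

lemma contDiff_expUnitary {m : WithTop ℕ∞} :
    ContDiff ℝ m fun X : u n => (expUnitary X : Matrix (Fin n) (Fin n) ℂ) :=
  contDiff_iff_contDiffAt.2 fun X =>
    ((NormedSpace.exp_analytic (𝕂 := ℝ) (X : Matrix (Fin n) (Fin n) ℂ)).contDiffAt).comp X
      (coeCLM n).contDiff.contDiffAt

lemma hasFDerivAt_expUnitary_zero :
    HasFDerivAt (fun X : u n => (expUnitary X : Matrix (Fin n) (Fin n) ℂ)) (coeCLM n) 0 := by
  have hexp : HasFDerivAt (NormedSpace.exp : Matrix (Fin n) (Fin n) ℂ → Matrix (Fin n) (Fin n) ℂ)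
      (1 : _ →L[ℝ] _) (coeCLM n 0) := by
    rw [map_zero]
    exact (hasStrictFDerivAt_exp_zero (𝕂 := ℝ)).hasFDerivAt
  exact hexp.comp 0 (coeCLM n).hasFDerivAt

lemma logDeriv_expUnitary_zero (L : E →L[ℝ] u n) : logDeriv (fun e => expUnitary (L e)) 0 = L := by
  have hexp : HasFDerivAt (fun X : u n => (expUnitary X : Matrix (Fin n) (Fin n) ℂ)) (coeCLM n)
      (L 0) := by
    rw [map_zero]
    exact hasFDerivAt_expUnitary_zero
  have hcomp : fderiv ℝ (fun e => (expUnitary (L e) : Matrix (Fin n) (Fin n) ℂ)) 0 =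
      (coeCLM n).comp L := (hexp.comp 0 L.hasFDerivAt).fderiv
  ext1 v
  rw [logDeriv, maurerCartan]
  simp only [Unitary.val_toUnits_apply, hcomp, map_zero, expUnitary_zero]
  simpa using! skewPart_coe (L v)

lemma aeval_minpoly_of_mem_adjointOrbit {h X : u n} (hX : X ∈ adjointOrbit h) :
    Polynomial.aeval (X : Matrix (Fin n) (Fin n) ℂ)
      (minpoly ℂ (h : Matrix (Fin n) (Fin n) ℂ)) = 0 := by
  obtain ⟨g, rfl⟩ := hX
  change Polynomial.aeval (Unitary.conjStarAlgAut ℂ _ g (h : Matrix (Fin n) (Fin n) ℂ)) _ = 0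
  rw [Polynomial.aeval_algHom_apply, minpoly.aeval, map_zero]

lemma eventually_eq_zero_of_add_mem_adjointOrbit (h : u n) :
    ∀ᶠ Z in nhds (0 : u n), ⁅h, Z⁆ = 0 → h + Z ∈ adjointOrbit h → Z = 0 := by
  have hcoe : Filter.Tendsto (coeCLM n) (nhds 0) (nhds 0) := by
    simpa only [map_zero] using (coeCLM n).continuous.tendsto 0
  have hroot := eventually_eq_zero_of_aeval_add_eq_zero (separable_minpoly_coe h)
    (minpoly.aeval ℂ (h : Matrix (Fin n) (Fin n) ℂ))
  filter_upwards [hcoe.eventually hroot] with Z hZ hlie horbit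
  exact Subtype.ext (hZ (commute_iff_lie_eq.2 (congrArg Subtype.val hlie))
    (aeval_minpoly_of_mem_adjointOrbit horbit))

end UnitaryAnalysis

section InverseFunction

variable {𝕜 E V : Type*} [RCLike 𝕜] [NormedAddCommGroup E] [NormedSpace 𝕜 E] [CompleteSpace E]
  [NormedAddCommGroup V] [NormedSpace 𝕜 V] {n : WithTop ℕ∞}

-- Shrinking to points where the derivative is invertible makes the inverse `C^n` on all of its
-- domain, rather than only at `f a`.
lemma exists_openPartialHomeomorph_contDiffOn_symm {f : E → V} (hf : ContDiff 𝕜 n f) (hn : n ≠ 0)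
    {a : E} {f' : E ≃L[𝕜] V} (hf' : HasFDerivAt f (f' : E →L[𝕜] V) a) {U : Set E}
    (hU : U ∈ nhds a) :
    ∃ e : OpenPartialHomeomorph E V, ⇑e = f ∧ a ∈ e.source ∧ e.source ⊆ U ∧
      ContDiffOn 𝕜 n e.symm e.target := by
  let W : Set E := interior U ∩ fderiv 𝕜 f ⁻¹' Set.range ((↑) : (E ≃L[𝕜] V) → E →L[𝕜] V)
  have hW : IsOpen W :=
    isOpen_interior.inter (ContinuousLinearEquiv.isOpen.preimage (hf.continuous_fderiv hn))
  have haW : a ∈ W := ⟨mem_interior_iff_mem_nhds.2 hU, f', hf'.fderiv.symm⟩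
  let e := (hf.contDiffAt.toOpenPartialHomeomorph f hf' hn).restrOpen W hW
  refine ⟨e, rfl, ⟨hf.contDiffAt.mem_toOpenPartialHomeomorph_source hf' hn, haW⟩,
    fun x hx => interior_subset hx.2.1, fun y hy => ?_⟩
  obtain ⟨T, hT⟩ := (e.map_target hy).2.2
  have hderiv : HasFDerivAt f (T : E →L[𝕜] V) (e.symm y) := by
    rw [hT]
    exact (hf.differentiable hn _).hasFDerivAt
  exact (e.contDiffAt_symm hy hderiv hf.contDiffAt).contDiffWithinAt

end InverseFunction

section SliceCharts

variable {𝕜 V E F : Type*} [NontriviallyNormedField 𝕜] [NormedAddCommGroup V] [NormedSpace 𝕜 V]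
  [NormedAddCommGroup E] [NormedSpace 𝕜 E] [NormedAddCommGroup F] [NormedSpace 𝕜 F]
  {n : WithTop ℕ∞}

variable (𝕜 n E F) in
/-- A slice chart of a subset `O` of a normed space: a `C^n` diffeomorphism from an open subset to
an open subset of `E × F`, under which `O` corresponds to `E × {0}`. -/
structure SliceChart (O : Set V) where
  chart : OpenPartialHomeomorph V (E × F)
  contDiffOn : ContDiffOn 𝕜 n chart chart.source
  contDiffOn_symm : ContDiffOn 𝕜 n chart.symm chart.target
  mem_iff : ∀ y ∈ chart.source, y ∈ O ↔ (chart y).2 = 0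

namespace SliceChart

variable {O : Set V}

/-- The image of a slice chart under a linear automorphism that preserves the subset. -/
def translate (S : SliceChart 𝕜 E F n O) (L : V ≃L[𝕜] V) (hL : ∀ y, L y ∈ O ↔ y ∈ O) :
    SliceChart 𝕜 E F n O where
  chart := L.symm.toHomeomorph.toOpenPartialHomeomorph.trans S.chart
  contDiffOn := S.contDiffOn.comp L.symm.contDiff.contDiffOn fun y hy => by simpa using hy
  contDiffOn_symm := L.contDiff.comp_contDiffOn (S.contDiffOn_symm.mono fun y hy => by
    simpa using hy)
  mem_iff y hy := by
    have hsource : L.symm y ∈ S.chart.source := by simpa using hy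
    rw [← L.apply_symm_apply y, hL, S.mem_iff _ hsource, L.apply_symm_apply]
    rfl

variable {S : SliceChart 𝕜 E F n O}

lemma translate_chart_apply {L : V ≃L[𝕜] V} {hL : ∀ y, L y ∈ O ↔ y ∈ O} (y : V) :
    (S.translate L hL).chart y = S.chart (L.symm y) := rfl

lemma translate_chart_symm_apply {L : V ≃L[𝕜] V} {hL : ∀ y, L y ∈ O ↔ y ∈ O} (p : E × F) :
    (S.translate L hL).chart.symm p = L (S.chart.symm p) := rfl

lemma mem_translate_source {L : V ≃L[𝕜] V} {hL : ∀ y, L y ∈ O ↔ y ∈ O} {y : V} :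
    y ∈ (S.translate L hL).chart.source ↔ L.symm y ∈ S.chart.source := by
  simp [translate]

lemma symm_mem {e : E} (he : (e, (0 : F)) ∈ S.chart.target) : S.chart.symm (e, 0) ∈ O := by
  rw [S.mem_iff _ (S.chart.map_target he), S.chart.right_inv he]

lemma fst_chart_prod_zero {y : V} (hy : y ∈ S.chart.source) (hyO : y ∈ O) :
    ((S.chart y).1, (0 : F)) = S.chart y :=
  Prod.ext rfl ((S.mem_iff y hy).1 hyO).symm

variable [Nonempty O]

open Classical in
variable (S) in
/-- The chart of the subset `O` given by a slice chart. The inverse takes an arbitrary value outside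
of the target. -/
def restr : OpenPartialHomeomorph O E where
  toFun y := (S.chart y).1
  invFun e := if h : S.chart.symm (e, 0) ∈ O then ⟨_, h⟩ else Classical.arbitrary O
  source := {y | (y : V) ∈ S.chart.source}
  target := {e | (e, (0 : F)) ∈ S.chart.target}
  map_source' y hy := by
    rw [Set.mem_ofPred_eq, fst_chart_prod_zero hy y.2]
    exact S.chart.map_source hy
  map_target' e he := by
    rw [dif_pos (symm_mem he)]
    exact S.chart.map_target he
  left_inv' y hy := by
    have hinv : S.chart.symm ((S.chart y).1, 0) = y := by
      rw [fst_chart_prod_zero hy y.2, S.chart.left_inv hy]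
    simp [hinv]
  right_inv' e he := by simp only [dif_pos (symm_mem he), S.chart.right_inv he]
  open_source := S.chart.open_source.preimage continuous_subtype_val
  open_target := S.chart.open_target.preimage (by fun_prop)
  continuousOn_toFun := continuous_fst.comp_continuousOn
    (S.chart.continuousOn.comp continuous_subtype_val.continuousOn fun _ hy => hy)
  continuousOn_invFun := by
    rw [Topology.IsEmbedding.subtypeVal.continuousOn_iff]
    refine (S.chart.continuousOn_symm.comp (f := fun e : E => (e, (0 : F)))
      (by fun_prop) fun e he => he).congr fun e he => ?_
    simp [symm_mem he]

lemma restr_apply (y : O) : S.restr y = (S.chart y).1 := rfl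

lemma mem_restr_source {y : O} : y ∈ S.restr.source ↔ (y : V) ∈ S.chart.source := Iff.rfl

lemma coe_restr_symm {e : E} (he : e ∈ S.restr.target) :
    (S.restr.symm e : V) = S.chart.symm (e, 0) :=
  congrArg Subtype.val (dif_pos (symm_mem he))

lemma contDiffOn_symm_prod_zero :
    ContDiffOn 𝕜 n (fun e => S.chart.symm (e, 0)) S.restr.target :=
  S.contDiffOn_symm.comp (f := fun e : E => (e, (0 : F))) (by fun_prop) fun _ he => he

lemma contDiffOn_restr_symm_trans_restr (S T : SliceChart 𝕜 E F n O) :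
    ContDiffOn 𝕜 n (S.restr.symm.trans T.restr) (S.restr.symm.trans T.restr).source := by
  have hmem : ∀ e ∈ (S.restr.symm.trans T.restr).source, S.chart.symm (e, 0) ∈ T.chart.source :=
    fun e he => coe_restr_symm (S := S) he.1 ▸ mem_restr_source.1 he.2
  have hsmooth : ContDiffOn 𝕜 n (fun e => (T.chart (S.chart.symm (e, 0))).1)
      (S.restr.symm.trans T.restr).source :=
    contDiff_fst.comp_contDiffOn
      (T.contDiffOn.comp (contDiffOn_symm_prod_zero.mono fun e he => he.1) hmem)
  refine hsmooth.congr fun e he => ?_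
  rw [OpenPartialHomeomorph.trans_apply, restr_apply, coe_restr_symm he.1]

/-- The manifold structure on `O` given by slice charts around all of its points. -/
@[reducible]
def chartedSpace (S : O → SliceChart 𝕜 E F n O) (hS : ∀ x, (x : V) ∈ (S x).chart.source) :
    ChartedSpace E O where
  atlas := Set.range fun x => (S x).restr
  chartAt x := (S x).restr
  mem_chart_source x := hS x
  chart_mem_atlas x := ⟨x, rfl⟩

variable {S : O → SliceChart 𝕜 E F n O} {hS : ∀ x, (x : V) ∈ (S x).chart.source}

lemma isManifold : letI := chartedSpace S hS; IsManifold 𝓘(𝕜, E) n O := by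
  let _ := chartedSpace S hS
  refine isManifold_of_contDiffOn _ _ _ ?_
  rintro _ _ ⟨x, rfl⟩ ⟨y, rfl⟩
  simpa only [modelWithCornersSelf_coe, modelWithCornersSelf_coe_symm, Function.comp_id,
    Function.id_comp, Set.range_id, Set.inter_univ, Set.preimage_id] using
    contDiffOn_restr_symm_trans_restr (S x) (S y)

lemma isSmoothEmbedding (L : (E × F) ≃L[𝕜] V) : letI := chartedSpace S hS
    Manifold.IsSmoothEmbedding 𝓘(𝕜, E) 𝓘(𝕜, V) n (Subtype.val : O → V) := by
  let _ := chartedSpace S hS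
  have := isManifold (S := S) (hS := hS)
  refine ⟨Manifold.IsImmersionOfComplement.isImmersion (F := F) fun x => ?_,
    Topology.IsEmbedding.subtypeVal⟩
  refine Manifold.IsImmersionAtOfComplement.mk_of_charts L (S x).restr
    ((S x).chart.trans L.toHomeomorph.toOpenPartialHomeomorph) (hS x) ?_ ?_ ?_ ?_ ?_
  · simpa using hS x
  · exact IsManifold.chart_mem_maximalAtlas (I := 𝓘(𝕜, E)) (n := n) x
  · refine OpenPartialHomeomorph.mem_maximalAtlas_of_contMDiffOn (I := 𝓘(𝕜, V)) _ ?_ ?_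
    · rw [contMDiffOn_iff_contDiffOn]
      exact L.contDiff.comp_contDiffOn ((S x).contDiffOn.mono fun y hy => by simpa using hy)
    · rw [contMDiffOn_iff_contDiffOn]
      exact (S x).contDiffOn_symm.comp L.symm.contDiff.contDiffOn fun y hy => by simpa using hy
  · intro y hy
    simpa using mem_restr_source.1 hy
  · intro e he
    have htarget : e ∈ (S x).restr.target := by simpa using he
    simp [coe_restr_symm htarget, (S x).chart.right_inv htarget]

end SliceChart

lemma exists_sliceChart {𝕜 E F V : Type*} [RCLike 𝕜] [NormedAddCommGroup E] [NormedSpace 𝕜 E]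
    [CompleteSpace E] [NormedAddCommGroup F] [NormedSpace 𝕜 F] [CompleteSpace F]
    [NormedAddCommGroup V] [NormedSpace 𝕜 V] {O : Set V} {f : E × F → V} (hf : ContDiff 𝕜 n f)
    (hn : n ≠ 0) {a : E × F} {f' : (E × F) ≃L[𝕜] V} (hf' : HasFDerivAt f (f' : E × F →L[𝕜] V) a)
    (hO : ∀ᶠ p in nhds a, f p ∈ O ↔ p.2 = 0) :
    ∃ S : SliceChart 𝕜 E F n O, ⇑S.chart.symm = f ∧ a ∈ S.chart.target := by
  obtain ⟨e, he, ha, hsource, hsymm⟩ := exists_openPartialHomeomorph_contDiffOn_symm hf hn hf' hO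
  refine ⟨⟨e.symm, hsymm, ?_, fun y hy => ?_⟩, ?_, ha⟩
  · rw [OpenPartialHomeomorph.symm_symm, he]
    exact hf.contDiffOn
  · have hiff : f (e.symm y) ∈ O ↔ (e.symm y).2 = 0 := hsource (e.map_target hy)
    rwa [← he, e.right_inv hy] at hiff
  · rw [OpenPartialHomeomorph.symm_symm, he]

end SliceCharts

section Potential

open scoped Matrix.Norms.L2Operator

variable {n : ℕ} {h : u n} {E : Type*} [NormedAddCommGroup E] [NormedSpace ℝ E]

/-- The pullback under `k : E → U(n)` of the left-invariant `1`-form on `U(n)` whose value at the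
identity is `B(h, ·)`. The pullback of the orbit form under `Ad(k) h` is minus the exterior
derivative of this form. -/
def potential (h : u n) (k : E → Matrix.unitaryGroup (Fin n) ℂ) : E → E [⋀^Fin 1]→L[ℝ] ℝ :=
  leftInvariantForm ℝ ((LinearMap.toContinuousLinearMap (killingForm ℝ (u n) h)).comp (skewPart n))
    fun e => Unitary.toUnits (k e)

variable {k : E → Matrix.unitaryGroup (Fin n) ℂ}
  (hk : ContDiff ℝ ∞ fun e => (k e : Matrix (Fin n) (Fin n) ℂ))

include hk

lemma contDiff_potential : ContDiff ℝ ∞ (potential h k) :=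
  contDiff_leftInvariantForm _ hk (by simp)

lemma contDiff_extDeriv_potential : ContDiff ℝ ∞ (extDeriv (potential h k)) :=
  (ContinuousAlternatingMap.alternatizeUncurryFinCLM ℝ E ℝ).contDiff.comp
    ((contDiff_potential hk).fderiv_right (by simp))

lemma neg_extDeriv_potential_apply (e v w : E) : (-extDeriv (potential h k) e) ![v, w] =
    killingForm ℝ (u n) h ⁅logDeriv k e v, logDeriv k e w⁆ := by
  rw [ContinuousAlternatingMap.neg_apply, potential,
    extDeriv_leftInvariantForm_skewPart _ hk ENat.LEInfty.out, neg_neg]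
  rfl

lemma fderiv_Ad_const_apply (e v : E) :
    fderiv ℝ (fun e => Ad (k e) h) e v = Ad (k e) ⁅logDeriv k e v, h⁆ := by
  rw [fderiv_Ad_apply (hk.differentiable (by simp) e) (differentiableAt_const h),
    fderiv_const_apply, zero_apply, add_zero]

end Potential

section OrbitForms

variable {n : ℕ} {h : u n}

lemma Ad_mem_adjointOrbit_iff (g : Matrix.unitaryGroup (Fin n) ℂ) (y : u n) :
    Ad g y ∈ adjointOrbit h ↔ y ∈ adjointOrbit h := by
  refine ⟨fun hy => ?_, fun hy => Ad_mem_adjointOrbit g ⟨y, hy⟩⟩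
  simpa only [← Ad_mul, inv_mul_cancel, Ad_one] using Ad_mem_adjointOrbit g⁻¹ ⟨_, hy⟩

/-- The adjoint action of a unitary matrix as a continuous linear automorphism. -/
def AdL (g : Matrix.unitaryGroup (Fin n) ℂ) : u n ≃L[ℝ] u n :=
  (AdEquiv g).toLinearEquiv.toContinuousLinearEquiv

lemma AdL_apply (g : Matrix.unitaryGroup (Fin n) ℂ) (X : u n) : AdL g X = Ad g X := rfl

lemma AdL_mem_adjointOrbit_iff {g : Matrix.unitaryGroup (Fin n) ℂ} {y : u n} :
    AdL g y ∈ adjointOrbit h ↔ y ∈ adjointOrbit h := Ad_mem_adjointOrbit_iff g y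

lemma Ad_lie_eq_lie_Ad_neg (g : Matrix.unitaryGroup (Fin n) ℂ) (a : u n) :
    Ad g ⁅a, h⁆ = ⁅Ad g h, Ad g (-a)⁆ := by
  rw [← Ad_lie, lie_neg, lie_skew]

lemma killingForm_Ad_lie_Ad_neg (g : Matrix.unitaryGroup (Fin n) ℂ) (a b : u n) :
    killingForm ℝ (u n) (Ad g h) ⁅Ad g (-a), Ad g (-b)⁆ = killingForm ℝ (u n) h ⁅a, b⁆ := by
  rw [← Ad_lie, killingForm_Ad, neg_lie, lie_neg, neg_neg]

variable {E : Type*} [NormedAddCommGroup E] [NormedSpace ℝ E] [ChartedSpace E (adjointOrbit h)]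
  {Ω Ω' : TwoFormField E (adjointOrbit h)}

lemma IsOrbitForm.apply_eq (hΩ : IsOrbitForm Ω) {x : adjointOrbit h}
    {g : Matrix.unitaryGroup (Fin n) ℂ} (hx : (x : u n) = Ad g h) {a b : u n}
    {v w : TangentSpace 𝓘(ℝ, E) x} (hv : inclDeriv E x v = Ad g ⁅a, h⁆)
    (hw : inclDeriv E x w = Ad g ⁅b, h⁆) :
    Ω x ![v, w] = killingForm ℝ (u n) h ⁅a, b⁆ := by
  rw [Ad_lie_eq_lie_Ad_neg, ← hx] at hv hw
  rw [hΩ x _ _ v w hv hw, hx, killingForm_Ad_lie_Ad_neg]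

lemma IsOrbitForm.unique
    (hrange : ∀ x : adjointOrbit h, Set.range (inclDeriv E x) = {v | ∃ X : u n, v = ⁅(x : u n), X⁆})
    (hΩ : IsOrbitForm Ω) (hΩ' : IsOrbitForm Ω') : Ω' = Ω := by
  funext x
  refine continuousAlternatingMap_ext_pair (E := E) fun v w => ?_
  obtain ⟨X, hX⟩ := (hrange x).subset (Set.mem_range_self v)
  obtain ⟨Y, hY⟩ := (hrange x).subset (Set.mem_range_self w)
  exact (hΩ' x X Y v w hX hY).trans (hΩ x X Y v w hX hY).symm

lemma IsOrbitForm.nondegenerate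
    (hrange : ∀ x : adjointOrbit h, Set.range (inclDeriv E x) = {v | ∃ X : u n, v = ⁅(x : u n), X⁆})
    (hΩ : IsOrbitForm Ω) {x : adjointOrbit h} (hinj : Function.Injective (inclDeriv E x))
    {v : TangentSpace 𝓘(ℝ, E) x} (hv : ∀ w : TangentSpace 𝓘(ℝ, E) x, Ω x ![v, w] = 0) :
    v = 0 := by
  obtain ⟨X, hX⟩ := (hrange x).subset (Set.mem_range_self v)
  obtain ⟨w, hw⟩ := (hrange x).superset ⟨⁅(x : u n), X⁆, rfl⟩
  have hself : killingForm ℝ (u n) ⁅(x : u n), X⁆ ⁅(x : u n), X⁆ = 0 := by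
    rw [LieModule.traceForm_apply_lie_apply, ← hΩ x X _ v w hX hw, hv]
  refine (map_eq_zero_iff _ hinj).1 (hX.trans ?_)
  exact lie_eq_zero_of_killingForm_eq_zero isSymm_traceInner (fun _ => traceInner_self_pos)
    lieInvariant_traceInner hself

section Invariance

variable (hemb : Manifold.IsSmoothEmbedding 𝓘(ℝ, E) 𝓘(ℝ, u n) ∞
  (Subtype.val : adjointOrbit h → u n))

include hemb

lemma contMDiff_orbitAct (g : Matrix.unitaryGroup (Fin n) ℂ) :
    ContMDiff 𝓘(ℝ, E) 𝓘(ℝ, E) ∞ (orbitAct g : adjointOrbit h → adjointOrbit h) := by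
  have hcomp : ContMDiff 𝓘(ℝ, E) 𝓘(ℝ, u n) ∞
      (Subtype.val ∘ (orbitAct g : adjointOrbit h → adjointOrbit h)) :=
    (AdL g).contDiff.contMDiff.comp hemb.contMDiff
  rw [ContMDiff.iff_comp_isImmersion hemb.isImmersion]
  exact ⟨Topology.IsEmbedding.subtypeVal.continuous_iff.2 hcomp.continuous, hcomp⟩

lemma inclDeriv_mfderiv_orbitAct (g : Matrix.unitaryGroup (Fin n) ℂ) (x : adjointOrbit h)
    (v : TangentSpace 𝓘(ℝ, E) x) :
    inclDeriv E (orbitAct g x) (mfderiv 𝓘(ℝ, E) 𝓘(ℝ, E) (orbitAct g) x v) =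
      Ad g (inclDeriv E x v) := by
  have hincl : ∀ y : adjointOrbit h, MDifferentiableAt 𝓘(ℝ, E) 𝓘(ℝ, u n)
      (Subtype.val : adjointOrbit h → u n) y := fun y =>
    (hemb.contMDiff y).mdifferentiableAt (by simp)
  have hleft := mfderiv_comp x (hincl (orbitAct g x))
    ((contMDiff_orbitAct hemb g x).mdifferentiableAt (by simp))
  have hright := mfderiv_comp x (AdL g).differentiableAt.mdifferentiableAt (hincl x)
  rw [mfderiv_eq_fderiv, (AdL g).fderiv] at hright
  exact congrArg (fun T => T v) (hleft.symm.trans hright)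

lemma IsOrbitForm.isInvariant
    (hrange : ∀ x : adjointOrbit h, Set.range (inclDeriv E x) = {v | ∃ X : u n, v = ⁅(x : u n), X⁆})
    (hΩ : IsOrbitForm Ω) : IsInvariant Ω := by
  refine fun g => ⟨contMDiff_orbitAct hemb g, fun x =>
    continuousAlternatingMap_ext_pair (E := E) fun v w => ?_⟩
  have hact : ∀ (X : u n) (v : TangentSpace 𝓘(ℝ, E) x), inclDeriv E x v = ⁅(x : u n), X⁆ →
      inclDeriv E (orbitAct g x) (mfderiv 𝓘(ℝ, E) 𝓘(ℝ, E) (orbitAct g) x v) =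
        ⁅Ad g x, Ad g X⁆ := fun X v hX => by
    rw [inclDeriv_mfderiv_orbitAct hemb, hX, Ad_lie]
  obtain ⟨X, hX⟩ := (hrange x).subset (Set.mem_range_self v)
  obtain ⟨Y, hY⟩ := (hrange x).subset (Set.mem_range_self w)
  refine (compContinuousLinearMap_apply_pair (E := E) (F := E) _ _ v w).trans ?_
  calc Ω (orbitAct g x) ![_, _] = killingForm ℝ (u n) (Ad g x) ⁅Ad g X, Ad g Y⁆ :=
        hΩ (orbitAct g x) _ _ _ _ (hact X v hX) (hact Y w hY)
    _ = killingForm ℝ (u n) x ⁅X, Y⁆ := by rw [← Ad_lie, killingForm_Ad]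
    _ = Ω x ![v, w] := (hΩ x X Y v w hX hY).symm

end Invariance

section Charts

open scoped Matrix.Norms.L2Operator

variable {k : E → Matrix.unitaryGroup (Fin n) ℂ}
  (hk : ContDiff ℝ ∞ fun e => (k e : Matrix (Fin n) (Fin n) ℂ))
  [IsManifold 𝓘(ℝ, E) ∞ (adjointOrbit h)]
  (hemb : Manifold.IsSmoothEmbedding 𝓘(ℝ, E) 𝓘(ℝ, u n) ∞
    (Subtype.val : adjointOrbit h → u n))
  {e : OpenPartialHomeomorph (adjointOrbit h) E} (he : e ∈ atlas E (adjointOrbit h))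
  (hek : ∀ y ∈ e.target, (e.symm y : u n) = Ad (k y) h)

include hk hemb he hek

lemma inclDeriv_mfderiv_symm {y : E} (hy : y ∈ e.target) (v : E) :
    inclDeriv E (e.symm y) (mfderiv 𝓘(ℝ, E) 𝓘(ℝ, E) e.symm y v) =
      Ad (k y) ⁅logDeriv k y v, h⁆ := by
  have := IsManifold.of_le (I := 𝓘(ℝ, E)) (M := adjointOrbit h) (m := 1) (n := ∞) (by simp)
  have hval : MDifferentiableAt 𝓘(ℝ, E) 𝓘(ℝ, u n) (Subtype.val : adjointOrbit h → u n) (e.symm y) :=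
    (hemb.contMDiff _).mdifferentiableAt (by simp)
  have hchain := mfderiv_comp y hval (mdifferentiableAt_atlas_symm (I := 𝓘(ℝ, E)) he hy)
  have hlocal : (Subtype.val : adjointOrbit h → u n) ∘ e.symm =ᶠ[nhds y] fun y => Ad (k y) h :=
    Filter.eventuallyEq_of_mem (e.open_target.mem_nhds hy) hek
  rw [mfderiv_eq_fderiv, hlocal.fderiv_eq] at hchain
  rw [← fderiv_Ad_const_apply hk, hchain]
  rfl

lemma IsOrbitForm.inChart_eq (hΩ : IsOrbitForm Ω) {y : E} (hy : y ∈ e.target) :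
    Ω.inChart e y = -extDeriv (potential h k) y := by
  refine continuousAlternatingMap_ext_pair fun v w => ?_
  rw [neg_extDeriv_potential_apply hk, ← hΩ.apply_eq (hek y hy)
    (inclDeriv_mfderiv_symm hk hemb he hek hy v) (inclDeriv_mfderiv_symm hk hemb he hek hy w)]
  exact compContinuousLinearMap_apply_pair (E := E) (F := E) _ _ v w

lemma IsOrbitForm.contDiffOn_inChart (hΩ : IsOrbitForm Ω) :
    ContDiffOn ℝ ∞ (Ω.inChart e) e.target :=
  (contDiff_extDeriv_potential hk).neg.contDiffOn.congr fun _ => hΩ.inChart_eq hk hemb he hek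

lemma IsOrbitForm.extDeriv_inChart (hΩ : IsOrbitForm Ω) {y : E} (hy : y ∈ e.target) :
    extDeriv (Ω.inChart e) y = 0 := by
  have hexact : Ω.inChart e =ᶠ[nhds y] (-1 : ℝ) • extDeriv (potential h k) := by
    filter_upwards [e.open_target.mem_nhds hy] with z hz
    rw [hΩ.inChart_eq hk hemb he hek hz, Pi.smul_apply, neg_one_smul]
  rw [hexact.extDeriv_eq, extDeriv_smul,
    extDeriv_extDeriv (contDiff_potential hk) (by simp [ENat.LEInfty.out]),
    Pi.zero_apply, smul_zero]

end Charts

end OrbitForms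

section SliceAtBasePoint

open scoped Matrix.Norms.L2Operator

variable {n : ℕ} (h : u n)

/-- The range of `ad h`, which is the tangent space at `h` of its orbit. -/
def tangent : Submodule ℝ (u n) := LinearMap.range (LieAlgebra.ad ℝ (u n) h : u n →ₗ[ℝ] u n)

/-- The centralizer of `h` in `𝔲(n)`, which is a complement of the tangent space at `h` of its
orbit. -/
def normal : Submodule ℝ (u n) := LinearMap.ker (LieAlgebra.ad ℝ (u n) h : u n →ₗ[ℝ] u n)

/-- The model space of the orbit of `h`. -/
abbrev Model : Type := EuclideanSpace ℝ (Fin (Module.finrank ℝ (tangent h)))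

/-- A choice of coordinates on the tangent space of the orbit at `h`. -/
def modelEquiv : Model h ≃ₗ[ℝ] tangent h :=
  LinearEquiv.ofFinrankEq _ _ finrank_euclideanSpace_fin

/-- The decomposition of `𝔲(n)` into the range and the kernel of `ad h`. -/
def splitting : (Model h × normal h) ≃L[ℝ] u n :=
  ((modelEquiv h).prodCongr (LinearEquiv.refl ℝ (normal h)) ≪≫ₗ
    Submodule.prodEquivOfIsCompl (tangent h) (normal h)
      (isCompl_range_ker_ad (fun _ => traceInner_self_pos) lieInvariant_traceInner h)
    ).toContinuousLinearEquiv

lemma splitting_apply (p : Model h × normal h) : splitting h p = modelEquiv h p.1 + p.2 := rfl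

lemma exists_lie_eq_modelEquiv :
    ∃ L : Model h →L[ℝ] u n, ∀ v, ⁅L v, h⁆ = (modelEquiv h v : u n) := by
  obtain ⟨s, hs⟩ := (LieAlgebra.ad ℝ (u n) h).rangeRestrict.exists_rightInverse_of_surjective
    (LinearMap.range_rangeRestrict _)
  refine ⟨LinearMap.toContinuousLinearMap (-s ∘ₗ (modelEquiv h).toLinearMap), fun v => ?_⟩
  have hv : ⁅h, s (modelEquiv h v)⁆ = (modelEquiv h v : u n) :=
    congrArg Subtype.val (LinearMap.congr_fun hs (modelEquiv h v))
  change ⁅-s (modelEquiv h v), h⁆ = (modelEquiv h v : u n)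
  rw [neg_lie, lie_skew, hv]

/-- A linear section of the map `X ↦ [X, h]` from `𝔲(n)` onto the tangent space of the orbit. -/
def modelLift : Model h →L[ℝ] u n := (exists_lie_eq_modelEquiv h).choose

lemma lie_modelLift (v : Model h) : ⁅modelLift h v, h⁆ = (modelEquiv h v : u n) :=
  (exists_lie_eq_modelEquiv h).choose_spec v

/-- A local section of the projection of `U(n)` onto the orbit of `h`. -/
def expSection (v : Model h) : Matrix.unitaryGroup (Fin n) ℂ := expUnitary (modelLift h v)

lemma expSection_zero : expSection h 0 = 1 := by rw [expSection, map_zero, expUnitary_zero]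

lemma contDiff_expSection :
    ContDiff ℝ ∞ fun v => (expSection h v : Matrix (Fin n) (Fin n) ℂ) :=
  contDiff_expUnitary.comp (modelLift h).contDiff

lemma logDeriv_expSection_zero : logDeriv (expSection h) 0 = modelLift h :=
  logDeriv_expUnitary_zero (modelLift h)

/-- The slice map `(v, Z) ↦ Ad(k) (h + Z)`, where `k` is the value at `v` of the local section of
`U(n)` and `Z` commutes with `h`. -/
def sliceMap (p : Model h × normal h) : u n := Ad (expSection h p.1) (h + p.2)

lemma sliceMap_prod_zero (v : Model h) : sliceMap h (v, 0) = Ad (expSection h v) h := by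
  rw [sliceMap, ZeroMemClass.coe_zero, add_zero]

lemma contDiff_sliceMap : ContDiff ℝ ∞ (sliceMap h) :=
  contDiff_Ad ((contDiff_expSection h).comp contDiff_fst)
    (contDiff_const.add ((normal h).subtypeL.contDiff.comp contDiff_snd))

lemma hasFDerivAt_sliceMap_zero :
    HasFDerivAt (sliceMap h) (splitting h : (Model h × normal h) →L[ℝ] u n) 0 := by
  let fst : Model h × normal h →L[ℝ] Model h := .fst ℝ _ _
  let snd : Model h × normal h →L[ℝ] u n := (normal h).subtypeL.comp (.snd ℝ _ _)
  have hk : ContDiff ℝ ∞ fun p => (expSection h (fst p) : Matrix (Fin n) (Fin n) ℂ) :=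
    (contDiff_expSection h).comp contDiff_fst
  have hlog : logDeriv (fun p => expSection h (fst p)) 0 = (modelLift h).comp fst :=
    logDeriv_expUnitary_zero ((modelLift h).comp fst)
  have hadd : HasFDerivAt (fun p => h + snd p) snd 0 := snd.hasFDerivAt.const_add h
  refine ((contDiff_sliceMap h).differentiable (by simp) 0).hasFDerivAt.congr_fderiv ?_
  refine ContinuousLinearMap.ext fun p => ?_
  refine (fderiv_Ad_apply (hk.differentiable (by simp) 0) hadd.differentiableAt p).trans ?_
  rw [hlog, hadd.fderiv, map_zero, expSection_zero, Ad_one, map_zero, add_zero,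
    ContinuousLinearMap.comp_apply, lie_modelLift]
  exact (splitting_apply h p).symm

lemma eventually_sliceMap_mem_adjointOrbit_iff :
    ∀ᶠ p in nhds 0, sliceMap h p ∈ adjointOrbit h ↔ p.2 = 0 := by
  have hsnd : Filter.Tendsto (fun p : Model h × normal h => (p.2 : u n)) (nhds 0) (nhds 0) :=
    ((normal h).subtypeL.continuous.comp continuous_snd).tendsto 0
  filter_upwards [hsnd.eventually (eventually_eq_zero_of_add_mem_adjointOrbit h)] with p hp
  rw [sliceMap, Ad_mem_adjointOrbit_iff]
  refine ⟨fun hmem => Subtype.ext (hp p.2.2 hmem), fun hzero => ⟨1, ?_⟩⟩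
  rw [hzero, ZeroMemClass.coe_zero, add_zero, Ad_one]

lemma exists_sliceChart_adjointOrbit :
    ∃ S : SliceChart ℝ (Model h) (normal h) ∞ (adjointOrbit h),
      ⇑S.chart.symm = sliceMap h ∧ 0 ∈ S.chart.target :=
  have := FiniteDimensional.complete ℝ (normal h)
  exists_sliceChart (contDiff_sliceMap h) (by simp) (hasFDerivAt_sliceMap_zero h)
    (eventually_sliceMap_mem_adjointOrbit_iff h)

/-- The slice chart of the orbit around its base point `h`. -/
def baseSlice : SliceChart ℝ (Model h) (normal h) ∞ (adjointOrbit h) :=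
  (exists_sliceChart_adjointOrbit h).choose

lemma baseSlice_chart_symm : ⇑(baseSlice h).chart.symm = sliceMap h :=
  (exists_sliceChart_adjointOrbit h).choose_spec.1

lemma baseSlice_chart_symm_zero : (baseSlice h).chart.symm 0 = h := by
  rw [baseSlice_chart_symm, ← Prod.mk_zero_zero, sliceMap_prod_zero, expSection_zero, Ad_one]

lemma zero_mem_baseSlice_target : 0 ∈ (baseSlice h).chart.target :=
  (exists_sliceChart_adjointOrbit h).choose_spec.2

lemma self_mem_baseSlice_source : h ∈ (baseSlice h).chart.source := by
  simpa only [baseSlice_chart_symm_zero] using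
    (baseSlice h).chart.map_target (zero_mem_baseSlice_target h)

lemma baseSlice_chart_self : (baseSlice h).chart h = 0 := by
  simpa only [baseSlice_chart_symm_zero] using
    (baseSlice h).chart.right_inv (zero_mem_baseSlice_target h)

end SliceAtBasePoint

section OrbitManifold

open scoped Matrix.Norms.L2Operator

variable {n : ℕ} {h : u n}

instance instNonemptyOrbit : Nonempty (adjointOrbit h) := ⟨⟨h, 1, (Ad_one h).symm⟩⟩

/-- A unitary matrix that moves `h` to the given point of its orbit. -/
def mover (x : adjointOrbit h) : Matrix.unitaryGroup (Fin n) ℂ := x.2.choose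

lemma Ad_mover (x : adjointOrbit h) : Ad (mover x) h = x := x.2.choose_spec.symm

lemma AdL_mover_symm (x : adjointOrbit h) : (AdL (mover x)).symm x = h :=
  (AdL (mover x)).symm_apply_eq.2 (Ad_mover x).symm

/-- The slice chart of the orbit around a given point, obtained from the one around `h` by the
adjoint action. -/
def orbitSlice (x : adjointOrbit h) : SliceChart ℝ (Model h) (normal h) ∞ (adjointOrbit h) :=
  (baseSlice h).translate (AdL (mover x)) fun _ => AdL_mem_adjointOrbit_iff

lemma mem_orbitSlice_source (x : adjointOrbit h) : (x : u n) ∈ (orbitSlice x).chart.source := by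
  rw [orbitSlice, SliceChart.mem_translate_source, AdL_mover_symm]
  exact self_mem_baseSlice_source h

lemma orbitSlice_restr_self (x : adjointOrbit h) : (orbitSlice x).restr x = 0 := by
  rw [SliceChart.restr_apply, orbitSlice, SliceChart.translate_chart_apply, AdL_mover_symm,
    baseSlice_chart_self, Prod.fst_zero]

lemma coe_orbitSlice_restr_symm (x : adjointOrbit h) {v : Model h}
    (hv : v ∈ (orbitSlice x).restr.target) :
    ((orbitSlice x).restr.symm v : u n) = Ad (mover x * expSection h v) h := by
  rw [SliceChart.coe_restr_symm hv, orbitSlice, SliceChart.translate_chart_symm_apply,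
    baseSlice_chart_symm, sliceMap_prod_zero, AdL_apply, Ad_mul]

variable (h) in
/-- The manifold structure of the orbit given by the slice charts. -/
@[reducible]
def orbitChartedSpace : ChartedSpace (Model h) (adjointOrbit h) :=
  SliceChart.chartedSpace orbitSlice mem_orbitSlice_source

attribute [local instance] orbitChartedSpace

instance isManifold_orbit : IsManifold 𝓘(ℝ, Model h) ∞ (adjointOrbit h) :=
  SliceChart.isManifold

lemma isSmoothEmbedding_orbit : Manifold.IsSmoothEmbedding 𝓘(ℝ, Model h) 𝓘(ℝ, u n) ∞
    (Subtype.val : adjointOrbit h → u n) :=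
  SliceChart.isSmoothEmbedding (splitting h)

lemma contDiff_mover_mul_expSection (x : adjointOrbit h) :
    ContDiff ℝ ∞ fun v => ((mover x * expSection h v : Matrix.unitaryGroup (Fin n) ℂ) :
      Matrix (Fin n) (Fin n) ℂ) :=
  contDiff_const.mul (contDiff_expSection h)

lemma fderiv_Ad_expSection_zero_apply (v : Model h) :
    fderiv ℝ (fun v => Ad (expSection h v) h) 0 v = ⁅modelLift h v, h⁆ := by
  rw [fderiv_Ad_const_apply (contDiff_expSection h), expSection_zero, Ad_one,
    logDeriv_expSection_zero]

lemma inclDeriv_apply (x : adjointOrbit h) (v : Model h) :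
    inclDeriv (Model h) x v = Ad (mover x) ⁅modelLift h v, h⁆ := by
  have hval : MDifferentiableAt 𝓘(ℝ, Model h) 𝓘(ℝ, u n) (Subtype.val : adjointOrbit h → u n) x :=
    (isSmoothEmbedding_orbit.contMDiff x).mdifferentiableAt (by simp)
  have hlocal : (fun v => ((orbitSlice x).restr.symm v : u n)) =ᶠ[nhds 0]
      fun v => AdL (mover x) (Ad (expSection h v) h) := by
    have hzero := (orbitSlice x).restr.map_source (mem_orbitSlice_source x)
    rw [orbitSlice_restr_self] at hzero
    filter_upwards [(orbitSlice x).restr.open_target.mem_nhds hzero] with v hv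
    rw [coe_orbitSlice_restr_symm x hv, Ad_mul, AdL_apply]
  have hchart : inclDeriv (Model h) x =
      fderiv ℝ (fun v => ((orbitSlice x).restr.symm v : u n)) ((orbitSlice x).restr x) := by
    rw [inclDeriv, hval.mfderiv]
    simp only [modelWithCornersSelf_coe, Set.range_id, fderivWithin_univ]
    rfl
  rw [hchart, orbitSlice_restr_self, hlocal.fderiv_eq, ← fderiv_Ad_expSection_zero_apply]
  exact congrArg (fun T => T v) (AdL (mover x)).comp_fderiv

lemma inclDeriv_apply_eq_lie (x : adjointOrbit h) (v : Model h) :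
    inclDeriv (Model h) x v = ⁅(x : u n), Ad (mover x) (-modelLift h v)⁆ := by
  rw [inclDeriv_apply, Ad_lie_eq_lie_Ad_neg, Ad_mover]

lemma inclDeriv_injective (x : adjointOrbit h) : Function.Injective (inclDeriv (Model h) x) := by
  intro v w hvw
  have hlie : ⁅modelLift h v, h⁆ = ⁅modelLift h w, h⁆ := (AdL (mover x)).injective
    ((inclDeriv_apply x v).symm.trans (hvw.trans (inclDeriv_apply x w)))
  exact (modelEquiv h).injective
    (Subtype.ext ((lie_modelLift h v).symm.trans (hlie.trans (lie_modelLift h w))))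

lemma range_inclDeriv (x : adjointOrbit h) :
    Set.range (inclDeriv (Model h) x) = {v | ∃ X : u n, v = ⁅(x : u n), X⁆} := by
  ext y
  constructor
  · rintro ⟨v, rfl⟩
    exact ⟨_, inclDeriv_apply_eq_lie x v⟩
  · rintro ⟨X, rfl⟩
    obtain ⟨v, hv⟩ := (modelEquiv h).surjective ⟨⁅h, Ad (mover x)⁻¹ X⁆, _, rfl⟩
    refine ⟨v, (inclDeriv_apply x v).trans ?_⟩
    rw [lie_modelLift, hv, Ad_lie, Ad_mover, ← Ad_mul, mul_inv_cancel, Ad_one]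

variable (h) in
/-- The Kirillov–Kostant–Souriau form of the orbit. The preferred charts at the points of the orbit
are translates of each other by the adjoint action, so that the form takes the same value at the
origin of each of them. -/
def orbitForm : TwoFormField (Model h) (adjointOrbit h) := fun _ =>
  (-extDeriv (potential h (expSection h)) 0 : Model h [⋀^Fin 2]→L[ℝ] ℝ)

lemma orbitForm_apply (x : adjointOrbit h) (v w : Model h) :
    orbitForm h x ![v, w] = killingForm ℝ (u n) h ⁅modelLift h v, modelLift h w⁆ := by
  rw [← logDeriv_expSection_zero]
  exact neg_extDeriv_potential_apply (contDiff_expSection h) 0 v w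

lemma isOrbitForm_orbitForm : IsOrbitForm (orbitForm h) := by
  intro x X Y v w hv hw
  rw [killingForm_lie_congr (hv.symm.trans (inclDeriv_apply_eq_lie x v))
    (hw.symm.trans (inclDeriv_apply_eq_lie x w))]
  refine (orbitForm_apply x v w).trans ?_
  rw [← killingForm_Ad_lie_Ad_neg (mover x), Ad_mover]

lemma isSymplectic_orbitForm : IsSymplectic (orbitForm h) where
  smooth := by
    rintro _ ⟨x, rfl⟩
    exact isOrbitForm_orbitForm.contDiffOn_inChart (contDiff_mover_mul_expSection x)
      isSmoothEmbedding_orbit ⟨x, rfl⟩ fun _ => coe_orbitSlice_restr_symm x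
  closed := by
    rintro _ ⟨x, rfl⟩ v hv
    exact isOrbitForm_orbitForm.extDeriv_inChart (contDiff_mover_mul_expSection x)
      isSmoothEmbedding_orbit ⟨x, rfl⟩ (fun _ => coe_orbitSlice_restr_symm x) hv
  nondegenerate x _ hv :=
    isOrbitForm_orbitForm.nondegenerate range_inclDeriv (inclDeriv_injective x) hv

end OrbitManifold

end UnitaryOrbit

end

theorem mainTheorem3 (n : ℕ) (h : UnitaryOrbit.u n) :
    ∃ (d : ℕ) (_ : ChartedSpace (EuclideanSpace ℝ (Fin d)) (UnitaryOrbit.adjointOrbit h)),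
      IsManifold 𝓘(ℝ, EuclideanSpace ℝ (Fin d)) ∞ (UnitaryOrbit.adjointOrbit h) ∧
      Manifold.IsSmoothEmbedding 𝓘(ℝ, EuclideanSpace ℝ (Fin d)) 𝓘(ℝ, UnitaryOrbit.u n) ∞
        (Subtype.val : UnitaryOrbit.adjointOrbit h → UnitaryOrbit.u n) ∧
      (∀ x : UnitaryOrbit.adjointOrbit h,
        Set.range (UnitaryOrbit.inclDeriv (EuclideanSpace ℝ (Fin d)) x) =
          {v | ∃ X : UnitaryOrbit.u n, v = ⁅(x : UnitaryOrbit.u n), X⁆}) ∧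
      ∃ Ω : UnitaryOrbit.TwoFormField (EuclideanSpace ℝ (Fin d)) (UnitaryOrbit.adjointOrbit h),
        UnitaryOrbit.IsOrbitForm Ω ∧
        (∀ Ω' : UnitaryOrbit.TwoFormField (EuclideanSpace ℝ (Fin d))
          (UnitaryOrbit.adjointOrbit h), UnitaryOrbit.IsOrbitForm Ω' → Ω' = Ω) ∧
        UnitaryOrbit.IsInvariant Ω ∧
        UnitaryOrbit.IsSymplectic Ω := by
  let _ := UnitaryOrbit.orbitChartedSpace h
  have hform := UnitaryOrbit.isOrbitForm_orbitForm (h := h)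
  exact ⟨_, UnitaryOrbit.orbitChartedSpace h, UnitaryOrbit.isManifold_orbit,
    UnitaryOrbit.isSmoothEmbedding_orbit, UnitaryOrbit.range_inclDeriv,
    UnitaryOrbit.orbitForm h, hform,
    fun _ => hform.unique UnitaryOrbit.range_inclDeriv,
    hform.isInvariant UnitaryOrbit.isSmoothEmbedding_orbit UnitaryOrbit.range_inclDeriv,
    UnitaryOrbit.isSymplectic_orbitForm⟩
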